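/- Let $M$ be a smooth manifold (finite-dimensional, Hausdorff, second countable, without boundary) that is contractible as a topological space, and let $q\colon E\to M$ be a smooth real vector bundle of finite rank. Then $E$ is trivial: for every $x_0\in M$ there is an isomorphism of smooth vector bundles over the identity of $M$ from $E$ to the trivial bundle $M\times E_{x_0}\to M$, where $E_{x_0}=q^{-1}(x_0)$ carries its standard smooth structure as a finite-dimensional real vector space; that is, there is a diffeomorphism $\Phi\colon E\to M\times E_{x_0}$ with $\mathrm{pr}_M\circ\Phi=q$ that restricts, for each $x\in M$, to a linear isomorphism $E_x\to\{x\}\times E_{x_0}$. -/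

import Mathlib

open Bundle
open scoped Manifold ContDiff

noncomputable section

/-- The smooth structure on a real topological vector space `V` whose only chart is a given
linear homeomorphism `L : V ≃L[ℝ] F` onto a normed space `F`. -/
@[reducible] def linearChartedSpace {V F : Type*} [AddCommGroup V] [Module ℝ V]
    [TopologicalSpace V] [NormedAddCommGroup F] [NormedSpace ℝ F] (L : V ≃L[ℝ] F) :
    ChartedSpace F V :=
  L.toHomeomorph.toOpenPartialHomeomorph.singletonChartedSpace rfl

/-- The smooth structure `linearChartedSpace L` does not depend on `L`: any linear homeomorphism
`L' : V ≃L[ℝ] F` is smooth with smooth inverse for it. -/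
theorem linearChartedSpace_contMDiff {V F : Type*} [AddCommGroup V] [Module ℝ V]
    [TopologicalSpace V] [NormedAddCommGroup F] [NormedSpace ℝ F] (L L' : V ≃L[ℝ] F) :
    letI := linearChartedSpace L
    ContMDiff 𝓘(ℝ, F) 𝓘(ℝ, F) ∞ L' ∧ ContMDiff 𝓘(ℝ, F) 𝓘(ℝ, F) ∞ L'.symm := by
  let _ := linearChartedSpace L
  have : IsManifold 𝓘(ℝ, F) ∞ V :=
    L.toHomeomorph.toOpenPartialHomeomorph.isManifold_singleton rfl
  constructor
  · rw [contMDiff_iff]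
    refine ⟨L'.continuous, fun x y => ?_⟩
    exact ((L.symm.trans L').contDiff (n := ∞)).contDiffOn
  · rw [contMDiff_iff]
    refine ⟨L'.symm.continuous, fun x y => ?_⟩
    exact ((L'.symm.trans L).contDiff (n := ∞)).contDiffOn

/-- The fibre `E x` of a vector bundle with model fibre `F`, as a smooth manifold: its standard
smooth structure as a vector space, with chart the linear isomorphism `E x ≃ F` given by a
local trivialization around `x`. -/
@[reducible] def fiberChartedSpace {M : Type*} [TopologicalSpace M]
    (F : Type*) [NormedAddCommGroup F] [NormedSpace ℝ F]
    (E : M → Type*) [∀ x, AddCommGroup (E x)] [∀ x, Module ℝ (E x)]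
    [∀ x, TopologicalSpace (E x)] [TopologicalSpace (TotalSpace F E)]
    [FiberBundle F E] [VectorBundle ℝ F E] (x : M) : ChartedSpace F (E x) :=
  linearChartedSpace ((trivializationAt F E x).continuousLinearEquivAt ℝ x
    (mem_baseSet_trivializationAt F E x))

/-- An isomorphism of smooth vector bundles, over the identity of `M`, from the bundle `E → M` to
the trivial bundle `M × E x₀ → M`: a diffeomorphism of the total spaces that covers the identity
and is linear on every fibre. -/
structure SmoothTrivialization {B : Type*} [NormedAddCommGroup B] [NormedSpace ℝ B]
    {M : Type*} [TopologicalSpace M] [ChartedSpace B M]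
    (F : Type*) [NormedAddCommGroup F] [NormedSpace ℝ F]
    (E : M → Type*) [∀ x, AddCommGroup (E x)] [∀ x, Module ℝ (E x)]
    [∀ x, TopologicalSpace (E x)] [TopologicalSpace (TotalSpace F E)]
    [FiberBundle F E] [VectorBundle ℝ F E] (x₀ : M) where
  toDiffeomorph :
    letI := fiberChartedSpace F E x₀
    Diffeomorph (𝓘(ℝ, B).prod 𝓘(ℝ, F)) (𝓘(ℝ, B).prod 𝓘(ℝ, F)) (TotalSpace F E) (M × E x₀) ∞
  fst_apply (e : TotalSpace F E) : (toDiffeomorph e).1 = e.proj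
  isLinear (x : M) : IsLinearMap ℝ (fun v : E x => (toDiffeomorph ⟨x, v⟩).2)

end

/-! A topological trivialization is built first, then smoothed. A partition of unity gives linear
maps `T x y` between fibres, the identity for `x = y` and hence injective near the diagonal
(`eventually_injective_transport`). Composing them along short steps of a contraction of `M` to `x₁`
carries each `E x` injectively, and continuously in `x`, into `E x₁`
(`exists_continuous_fiberwise_injective`). The resulting isomorphisms `R x` onto `F` pull a basis of
`F` back to a continuous frame. Smooth sections close enough to it still form a frame, since linear
independence is an open condition (`exists_contMDiff_frame`), and a smooth frame trivializes the
bundle. -/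

open Filter Topology

/-! ### Topological triviality by transport along a contraction -/

section Transport

variable {M : Type*} [TopologicalSpace M]
  {F : Type*} [NormedAddCommGroup F] [NormedSpace ℝ F]
  {E : M → Type*} [∀ x, AddCommGroup (E x)] [∀ x, Module ℝ (E x)]
  [∀ x, TopologicalSpace (E x)] [TopologicalSpace (TotalSpace F E)]
  [FiberBundle F E] [VectorBundle ℝ F E]

omit [NormedSpace ℝ F] [∀ x, AddCommGroup (E x)] [∀ x, Module ℝ (E x)]
  [∀ x, TopologicalSpace (E x)] [FiberBundle F E] [VectorBundle ℝ F E] in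
theorem Bundle.Trivialization.continuousAt_snd_symm_snd (φ ψ : Trivialization F (π F E))
    {e : TotalSpace F E} {y : M} (he : e.proj ∈ φ.baseSet) (hy : y ∈ φ.baseSet)
    (hy' : y ∈ ψ.baseSet) :
    ContinuousAt (fun p : TotalSpace F E × M =>
      (ψ (φ.toOpenPartialHomeomorph.symm (p.2, (φ p.1).2))).2) (e, y) := by
  have h1 : ContinuousAt (fun p : TotalSpace F E × M => (p.2, (φ p.1).2)) (e, y) := by
    have := φ.continuousOn.continuousAt (φ.open_source.mem_nhds (φ.mem_source.2 he))
    exact continuousAt_snd.prodMk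
      (continuousAt_snd.comp (ContinuousAt.comp (x := (e, y)) this continuousAt_fst))
  have h2 : ContinuousAt φ.toOpenPartialHomeomorph.symm (y, (φ e).2) :=
    φ.toOpenPartialHomeomorph.continuousAt_symm (φ.mem_target.2 hy)
  have h3 : ContinuousAt ψ (φ.toOpenPartialHomeomorph.symm (y, (φ e).2)) := by
    refine ψ.continuousOn.continuousAt (ψ.open_source.mem_nhds (ψ.mem_source.2 ?_))
    rwa [φ.proj_symm_apply' hy]
  exact continuousAt_snd.comp (ContinuousAt.comp (x := (e, y)) h3
    (ContinuousAt.comp (x := (e, y)) h2 h1))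

/-- On a paracompact base, the fibres of a vector bundle are related by linear maps which depend
continuously on both endpoints and are the identity on the diagonal. -/
theorem exists_continuous_transport [T2Space M] [ParacompactSpace M] :
    ∃ T : ∀ x y, E x →ₗ[ℝ] E y, (∀ x, T x x = LinearMap.id) ∧
      Continuous (fun p : TotalSpace F E × M =>
        (⟨p.2, T p.1.proj p.2 p.1.2⟩ : TotalSpace F E)) := by
  classical
  obtain ⟨ρ, hρ⟩ := PartitionOfUnity.exists_isSubordinate isClosed_univ
    (fun i : M => (trivializationAt F E i).baseSet) (fun i => (trivializationAt F E i).open_baseSet)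
    (fun x _ => Set.mem_iUnion.2 ⟨x, mem_baseSet_trivializationAt F E x⟩)
  let φ (i : M) := trivializationAt F E i
  -- The product vanishes as soon as either endpoint leaves the support of `ρ i`; the square roots
  -- make it `ρ i x` on the diagonal, so the weights sum to `1` there.
  let c (i x y : M) : ℝ := √(ρ i x) * √(ρ i y)
  let S (i x y : M) : E x →ₗ[ℝ] E y :=
    c i x y • (φ i).symmₗ ℝ y ∘ₗ (φ i).linearMapAt ℝ x
  have hsum (x y : M) (I : Finset M) (hI : Function.support (ρ · y) ⊆ I) :
      ∑ᶠ i, S i x y = ∑ i ∈ I, S i x y := by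
    refine finsum_eq_sum_of_support_subset _ fun i hi => hI fun h => hi ?_
    simp only at h
    simp [S, c, h]
  refine ⟨fun x y => ∑ᶠ i, S i x y, fun x => ?_, ?_⟩
  · change ∑ᶠ i, S i x x = _
    rw [hsum x x (ρ.finsupport x) (by simp)]
    ext v
    have : ∀ i ∈ ρ.finsupport x, S i x x v = ρ i x • v := by
      intro i hi
      have hx : x ∈ (φ i).baseSet :=
        hρ i (subset_closure (by simpa [ρ.mem_finsupport] using hi))
      simp only [S, c, LinearMap.smul_apply, LinearMap.comp_apply, Real.mul_self_sqrt (ρ.nonneg i x)]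
      rw [Trivialization.symmₗ_linearMapAt _ hx]
    rw [LinearMap.sum_apply, Finset.sum_congr rfl this, ← Finset.sum_smul,
      ρ.sum_finsupport (Set.mem_univ x), one_smul, LinearMap.id_apply]
  · rw [continuous_iff_continuousAt]
    rintro ⟨e, y⟩
    rw [FiberBundle.continuousAt_totalSpace]
    refine ⟨continuousAt_snd, ?_⟩
    let ψ := trivializationAt F E y
    have hy : y ∈ ψ.baseSet := mem_baseSet_trivializationAt F E y
    obtain ⟨I, hI⟩ := ρ.exists_finset_nhds y
    have hev : ∀ᶠ p : TotalSpace F E × M in 𝓝 (e, y),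
        ∑ i ∈ I, c i p.1.proj p.2 • (if p.1.proj ∈ (φ i).baseSet ∧ p.2 ∈ (φ i).baseSet then
          (ψ ((φ i).toOpenPartialHomeomorph.symm (p.2, ((φ i) p.1).2))).2 else 0)
        = (ψ ⟨p.2, (∑ᶠ i, S i p.1.proj p.2) p.1.2⟩).2 := by
      filter_upwards [continuousAt_snd.eventually hI,
        continuousAt_snd.eventually (ψ.open_baseSet.mem_nhds hy)] with p hp hpy
      have hψ (w : E p.2) : (ψ ⟨p.2, w⟩).2 = ψ.linearMapAt ℝ p.2 w :=
        (congrFun (ψ.coe_linearMapAt_of_mem hpy) w).symm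
      rw [hsum _ _ I hp.2, hψ, LinearMap.sum_apply, map_sum]
      refine Finset.sum_congr rfl fun i _ => ?_
      simp only [S, LinearMap.smul_apply, map_smul, LinearMap.comp_apply]
      split_ifs with h
      · rw [(φ i).symmₗ_apply h.2, (φ i).coe_linearMapAt_of_mem h.1, ← hψ, (φ i).mk_symm h.2]
      · by_cases h1 : p.1.proj ∈ (φ i).baseSet
        · rw [(φ i).symmₗ_apply_of_notMem fun h2 => h ⟨h1, h2⟩, map_zero]
        · rw [(φ i).linearMapAt_def_of_notMem h1]; simp
    refine ContinuousAt.congr ?_ hev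
    refine tendsto_finsetSum _ fun i _ => ?_
    have hc : Continuous fun p : TotalSpace F E × M => c i p.1.proj p.2 := by
      have := FiberBundle.continuous_proj F E
      have h2 := (ρ i).continuous
      simp only [c]
      fun_prop
    by_cases h : e.proj ∈ (φ i).baseSet ∧ y ∈ (φ i).baseSet
    · refine hc.continuousAt.smul (ContinuousAt.congr
        ((φ i).continuousAt_snd_symm_snd ψ h.1 h.2 hy) ?_)
      have h1 : ∀ᶠ p : TotalSpace F E × M in 𝓝 (e, y), p.1.proj ∈ (φ i).baseSet :=
        ((FiberBundle.continuous_proj F E).comp continuous_fst).continuousAt.eventually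
          ((φ i).open_baseSet.mem_nhds h.1)
      filter_upwards [h1, continuousAt_snd.eventually ((φ i).open_baseSet.mem_nhds h.2)]
        with p hp1 hp2
      rw [if_pos ⟨hp1, hp2⟩]
    -- Subordination kills the weight on a whole neighbourhood, so the jump of the `if` is harmless.
    · have h0 {z : M} (hz : z ∉ (φ i).baseSet) : ∀ᶠ z' in 𝓝 z, ρ i z' = 0 :=
        notMem_tsupport_iff_eventuallyEq.1 fun h' => hz (hρ i h')
      have : ∀ᶠ p : TotalSpace F E × M in 𝓝 (e, y), c i p.1.proj p.2 = 0 := by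
        by_cases h1 : e.proj ∈ (φ i).baseSet
        · filter_upwards [continuousAt_snd.eventually (h0 fun h2 => h ⟨h1, h2⟩)] with p hp
          simp only [c]
          rw [hp]; simp
        · have := ((FiberBundle.continuous_proj F E).comp continuous_fst).continuousAt
            (x := (e, y)) |>.eventually (h0 h1)
          filter_upwards [this] with p hp
          simp only [Function.comp] at hp
          simp [c, hp]
      refine ContinuousAt.congr (f := fun _ => (0 : F)) continuousAt_const ?_
      filter_upwards [this] with p hp
      rw [hp, zero_smul]

/-- A continuous transport which is the identity on the diagonal is injective near it. -/
theorem eventually_injective_transport [FiniteDimensional ℝ F] {T : ∀ x y, E x →ₗ[ℝ] E y}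
    (hid : ∀ x, T x x = LinearMap.id)
    (hT : Continuous (fun p : TotalSpace F E × M =>
      (⟨p.2, T p.1.proj p.2 p.1.2⟩ : TotalSpace F E))) (a : M) :
    ∀ᶠ p : M × M in 𝓝 (a, a), Function.Injective (T p.1 p.2) := by
  let φ := trivializationAt F E a
  have ha : a ∈ φ.baseSet := mem_baseSet_trivializationAt F E a
  -- By linearity the unit sphere suffices, and its compactness makes the neighbourhood uniform in
  -- `v`.
  have key : ∀ᶠ p : M × M in 𝓝 (a, a), ∀ v ∈ Metric.sphere (0 : F) 1,
      (φ ⟨p.2, T _ p.2 (φ.toOpenPartialHomeomorph.symm (p.1, v)).2⟩).2 ≠ 0 := by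
    refine (isCompact_sphere (0 : F) 1).eventually_forall_of_forall_eventually fun v hv => ?_
    have h1 : ContinuousAt (fun z : (M × M) × F =>
        (φ.toOpenPartialHomeomorph.symm (z.1.1, z.2), z.1.2)) ((a, a), v) := by
      have : ContinuousAt φ.toOpenPartialHomeomorph.symm (a, v) :=
        φ.toOpenPartialHomeomorph.continuousAt_symm (φ.mem_target.2 ha)
      exact (ContinuousAt.comp (x := ((a, a), v)) (f := fun z : (M × M) × F => (z.1.1, z.2)) this
        (by fun_prop)).prodMk (by fun_prop)
    have h2 := hT.continuousAt.comp h1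
    have h3 := continuousAt_snd.comp (ContinuousAt.comp (g := φ)
      (φ.continuousOn.continuousAt (φ.open_source.mem_nhds (φ.mem_source.2 ha))) h2)
    refine h3.eventually_ne ?_
    have hself (e : TotalSpace F E) (he : e.proj = a) :
        (⟨a, T e.proj a e.2⟩ : TotalSpace F E) = e := by
      subst he
      rw [hid]
      rfl
    simp only [Function.comp]
    rw [hself _ (φ.proj_symm_apply' ha), φ.apply_symm_apply' ha]
    rintro rfl
    simp at hv
  have hb1 : ∀ᶠ p : M × M in 𝓝 (a, a), p.1 ∈ φ.baseSet :=
    continuousAt_fst.eventually (φ.open_baseSet.mem_nhds ha)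
  have hb2 : ∀ᶠ p : M × M in 𝓝 (a, a), p.2 ∈ φ.baseSet :=
    continuousAt_snd.eventually (φ.open_baseSet.mem_nhds ha)
  filter_upwards [key, hb1, hb2] with p hp h1 h2
  rw [← LinearMap.ker_eq_bot, LinearMap.ker_eq_bot']
  intro w hw
  by_contra hw0
  let u := φ.linearMapAt ℝ p.1 w
  have hu : u ≠ 0 := fun h => hw0 (by
    rw [← φ.symmₗ_linearMapAt (R := ℝ) h1 w, show φ.linearMapAt ℝ p.1 w = 0 from h, map_zero])
  refine hp (‖u‖⁻¹ • u) (by simp [norm_smul, hu]) ?_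
  rw [← φ.mk_symm h1, ← φ.symmₗ_apply (R := ℝ) h1]
  simp only [map_smul, u, φ.symmₗ_linearMapAt h1, hw, smul_zero]
  simpa using congrFun (φ.coe_linearMapAt_of_mem (R := ℝ) h2).symm 0

/-- A neighbourhood `W` of the diagonal contains all short steps of a homotopy, where the length
of a short step depends continuously on the starting point. -/
theorem exists_continuous_step [T2Space M] [ParacompactSpace M] {h : M → ℝ → M}
    (hc : Continuous (Function.uncurry h)) {W : M → M → Prop}
    (hW : ∀ a, ∀ᶠ p : M × M in 𝓝 (a, a), W p.1 p.2) :
    ∃ ε : C(M, ℝ), ∀ x, 0 < ε x ∧ ∀ s ∈ Set.Icc (0 : ℝ) 1, W (h x s) (h x (s + ε x)) := by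
  -- Quantifying over all `d ≤ δ` makes `t x` an interval, so locally constant choices glue to a
  -- continuous one.
  let t (x : M) : Set ℝ :=
    {δ | 0 < δ ∧ ∀ d ∈ Set.Icc 0 δ, ∀ s ∈ Set.Icc (0 : ℝ) 1, W (h x s) (h x (s + d))}
  have ht (x : M) : Convex ℝ (t x) := by
    refine Set.OrdConnected.convex ⟨fun a ha b hb c hc => ⟨ha.1.trans_le hc.1, fun d hd => ?_⟩⟩
    exact hb.2 d ⟨hd.1, hd.2.trans hc.2⟩
  obtain ⟨ε, hε⟩ := exists_continuous_forall_mem_convex_of_local_const (t := t) ht fun x => by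
    have : ∀ᶠ z : M × ℝ in 𝓝 (x, 0), ∀ s ∈ Set.Icc (0 : ℝ) 1, W (h z.1 s) (h z.1 (s + z.2)) := by
      refine isCompact_Icc.eventually_forall_of_forall_eventually fun s _ => ?_
      have : ContinuousAt (fun z : (M × ℝ) × ℝ => (h z.1.1 z.2, h z.1.1 (z.2 + z.1.2)))
          ((x, 0), s) := by
        have h1 : Continuous fun z : (M × ℝ) × ℝ => h z.1.1 z.2 :=
          hc.comp (by fun_prop : Continuous fun z : (M × ℝ) × ℝ => (z.1.1, z.2))
        have h2 : Continuous fun z : (M × ℝ) × ℝ => h z.1.1 (z.2 + z.1.2) :=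
          hc.comp (by fun_prop : Continuous fun z : (M × ℝ) × ℝ => (z.1.1, z.2 + z.1.2))
        exact (h1.prodMk h2).continuousAt
      refine this.eventually (p := fun p => W p.1 p.2) ?_
      simpa using hW (h x s)
    rw [nhds_prod_eq, eventually_prod_iff] at this
    obtain ⟨p, hp, q, hq, hpq⟩ := this
    obtain ⟨δ, hδ, hball⟩ := Metric.eventually_nhds_iff.1 hq
    refine ⟨δ / 2, ?_⟩
    filter_upwards [hp] with y hy
    refine ⟨half_pos hδ, fun d hd => hpq hy (hball ?_)⟩
    rw [Real.dist_eq, sub_zero, abs_of_nonneg hd.1]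
    linarith [hd.2]
  exact ⟨ε, fun x => ⟨(hε x).1, (hε x).2 _ ⟨(hε x).1.le, le_rfl⟩⟩⟩

/-- A vector bundle over a contractible paracompact space is topologically trivial. -/
theorem exists_continuous_fiberwise_injective [T2Space M] [ParacompactSpace M]
    [ContractibleSpace M] [FiniteDimensional ℝ F] :
    ∃ R : ∀ x, E x →ₗ[ℝ] F, (∀ x, Function.Injective (R x)) ∧
      Continuous (fun e : TotalSpace F E => R e.proj e.2) := by
  obtain ⟨T, hid, hT⟩ := exists_continuous_transport (F := F) (E := E)
  obtain ⟨x₁, ⟨H⟩⟩ := id_nullhomotopic M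
  -- Clamping time keeps `h x` at `x₁` after time `1`, so steps may overshoot.
  let h (x : M) (r : ℝ) : M := H (Set.projIcc 0 1 zero_le_one r, x)
  have hc : Continuous (Function.uncurry h) :=
    H.continuous.comp ((continuous_projIcc.comp continuous_snd).prodMk continuous_fst)
  have h0 (x : M) : h x 0 = x := by simp [h]
  have h1 (x : M) {r : ℝ} (hr : 1 ≤ r) : h x r = x₁ := by simp [h, Set.projIcc_of_right_le _ hr]
  obtain ⟨ε, hε⟩ := exists_continuous_step hc
    (W := fun x y => Function.Injective (T x y)) (eventually_injective_transport hid hT)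
  have hinj {x y : M} (hxy : x = y) : Function.Injective (T x y) := by
    subst hxy; rw [hid]; exact Function.injective_id
  let L (k : ℕ) (x : M) : E x →ₗ[ℝ] E (h x (k * ε x)) :=
    k.rec (T _ _) fun k Lk => T (h x (k * ε x)) (h x ((k + 1 : ℕ) * ε x)) ∘ₗ Lk
  have hLs (k : ℕ) (x : M) : L (k + 1) x = T _ _ ∘ₗ L k x := rfl
  have hLinj (k : ℕ) (x : M) : Function.Injective (L k x) := by
    induction k with
    | zero => exact hinj (by simp [h0])
    | succ k ih =>
      rw [hLs, LinearMap.coe_comp]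
      refine Function.Injective.comp ?_ ih
      rcases le_total ((k : ℝ) * ε x) 1 with hk | hk
      · have := (hε x).2 (k * ε x) ⟨mul_nonneg k.cast_nonneg (hε x).1.le, hk⟩
        rwa [show (k : ℝ) * ε x + ε x = (k + 1 : ℕ) * ε x by push_cast; ring] at this
      · refine hinj ((h1 x hk).trans (h1 x ?_).symm)
        push_cast
        linarith [(hε x).1]
  have hhc (k : ℕ) : Continuous fun e : TotalSpace F E => h e.proj (k * ε e.proj) := by
    have := FiberBundle.continuous_proj F E
    exact hc.comp (this.prodMk (continuous_const.mul (ε.continuous.comp this)))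
  have hLc (k : ℕ) : Continuous fun e : TotalSpace F E => (⟨_, L k e.proj e.2⟩ : TotalSpace F E) := by
    induction k with
    | zero => exact hT.comp (continuous_id.prodMk (hhc 0))
    | succ k ih => exact hT.comp (ih.prodMk (hhc (k + 1)))
  let Q (k : ℕ) (x : M) : E x →ₗ[ℝ] E x₁ := T _ x₁ ∘ₗ L k x
  have hcomp {a b c : M} (hac : a = c) (hbc : b = c) : T b c ∘ₗ T a b = T a c := by
    subst hac hbc; simp [hid]
  have hQs {k : ℕ} {x : M} (hk : 1 ≤ k * ε x) : Q (k + 1) x = Q k x := by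
    simp only [Q, hLs, ← LinearMap.comp_assoc]
    rw [hcomp (h1 x hk) (h1 x (by push_cast; linarith [(hε x).1]))]
  have hQ {k l : ℕ} {x : M} (hk : 1 ≤ k * ε x) (hl : k ≤ l) : Q l x = Q k x := by
    induction l, hl using Nat.le_induction with
    | base => rfl
    | succ l hl ih =>
      rw [hQs, ih]
      exact hk.trans (mul_le_mul_of_nonneg_right (by exact_mod_cast hl) (hε x).1.le)
  let N (x : M) : ℕ := ⌈(ε x)⁻¹⌉₊
  have hN (x : M) : 1 ≤ N x * ε x := by
    have := mul_le_mul_of_nonneg_right (Nat.le_ceil (ε x)⁻¹) (hε x).1.le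
    rwa [inv_mul_cancel₀ (hε x).1.ne'] at this
  let φ := trivializationAt F E x₁
  have hx₁ : x₁ ∈ φ.baseSet := mem_baseSet_trivializationAt F E x₁
  refine ⟨fun x => φ.linearMapAt ℝ x₁ ∘ₗ Q (N x) x, fun x => ?_, ?_⟩
  · have hφ : Function.Injective (φ.linearMapAt ℝ x₁) :=
      Function.LeftInverse.injective (g := φ.symmₗ ℝ x₁) (φ.symmₗ_linearMapAt hx₁)
    exact hφ.comp ((hinj (h1 x (hN x))).comp (hLinj (N x) x))
  · have hQc (k : ℕ) :
        Continuous fun e : TotalSpace F E => φ.linearMapAt ℝ x₁ (Q k e.proj e.2) := by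
      rw [φ.coe_linearMapAt_of_mem hx₁]
      exact continuous_snd.comp (φ.continuousOn.comp_continuous
        (hT.comp ((hLc k).prodMk continuous_const)) fun e => φ.mem_source.2 hx₁)
    rw [continuous_iff_continuousAt]
    intro e
    -- `N` need not be locally constant, but `N e.proj + 1` steps suffice near `e`, and by `hQ`
    -- surplus steps change nothing.
    refine (hQc (N e.proj + 1)).continuousAt.congr ?_
    have hev : ∀ᶠ e' : TotalSpace F E in 𝓝 e, (ε e'.proj)⁻¹ < (N e.proj + 1 : ℕ) := by
      have := ((ε.continuous.comp (FiberBundle.continuous_proj F E)).continuousAt (x := e)).inv₀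
        (hε e.proj).1.ne'
      refine this.eventually_lt_const ?_
      push_cast
      exact (Nat.le_ceil _).trans_lt (lt_add_one _)
    filter_upwards [hev] with e' he'
    change _ = φ.linearMapAt ℝ x₁ (Q (N e'.proj) e'.proj e'.2)
    rw [← hQ (hN e'.proj) (Nat.ceil_le.2 he'.le)]

end Transport

/-! ### Smooth frames and smooth trivializations -/

section SmoothFrame

variable {B : Type*} [NormedAddCommGroup B] [NormedSpace ℝ B]
  {M : Type*} [TopologicalSpace M] [ChartedSpace B M]
  {F : Type*} [NormedAddCommGroup F] [NormedSpace ℝ F] [FiniteDimensional ℝ F]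
  {E : M → Type*} [∀ x, AddCommGroup (E x)] [∀ x, Module ℝ (E x)]
  [∀ x, TopologicalSpace (E x)] [TopologicalSpace (TotalSpace F E)]
  [FiberBundle F E] [VectorBundle ℝ F E]

/-- A smooth vector bundle that is topologically trivial has a smooth global frame. -/
theorem exists_contMDiff_frame [FiniteDimensional ℝ B] [T2Space M] [SigmaCompactSpace M]
    [IsManifold 𝓘(ℝ, B) ∞ M] [ContMDiffVectorBundle ∞ F E 𝓘(ℝ, B)]
    {R : ∀ x, E x →ₗ[ℝ] F} (hR : ∀ x, Function.Injective (R x))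
    (hc : Continuous (fun e : TotalSpace F E => R e.proj e.2))
    {ι : Type*} [Finite ι] (b : Module.Basis ι ℝ F) :
    ∃ s : ι → ∀ x, E x, (∀ i, ContMDiff 𝓘(ℝ, B) (𝓘(ℝ, B).prod 𝓘(ℝ, F)) ∞
      (fun x => TotalSpace.mk' F x (s i x))) ∧ ∀ x, LinearIndependent ℝ (fun i => s i x) := by
  have := Fintype.ofFinite ι
  -- Any family within `δ` of `b` is linearly independent. Asking that `R x` send the `i`-th section
  -- into the `δ`-ball at `b i` is a convex condition, so local solutions glue smoothly.
  obtain ⟨δ, hδ, hball⟩ := Metric.eventually_nhds_iff.1 b.linearIndependent.eventually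
  have hsurj (x : M) : Function.Surjective (R x) := by
    let e := (trivializationAt F E x).linearEquivAt ℝ x (mem_baseSet_trivializationAt F E x)
    have : FiniteDimensional ℝ (E x) := e.symm.finiteDimensional
    exact (LinearMap.injective_iff_surjective_of_finrank_eq_finrank e.finrank_eq).1 (hR x)
  have (i : ι) := exists_contMDiffSection_forall_mem_convex_of_local (n := ⊤) 𝓘(ℝ, B)
    (F_fiber := F) E
    (fun x => R x ⁻¹' Metric.ball (b i) δ)
    (fun x => (convex_ball (b i) δ).linear_preimage (R x)) fun x => by
      let φ := trivializationAt F E x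
      have hx : x ∈ φ.baseSet := mem_baseSet_trivializationAt F E x
      obtain ⟨w, hw⟩ := hsurj x (b i)
      let v := (φ ⟨x, w⟩).2
      have hs : ContMDiffOn 𝓘(ℝ, B) (𝓘(ℝ, B).prod 𝓘(ℝ, F)) ∞
          (fun y => TotalSpace.mk' F y (φ.symm y v)) φ.baseSet := by
        refine (φ.contMDiffOn_symm.comp (contMDiff_id.prodMk contMDiff_const).contMDiffOn
          fun y hy => φ.mem_target.2 hy).congr fun y hy => φ.mk_symm hy v
      have hev : ∀ᶠ y in 𝓝 x, R y (φ.symm y v) ∈ Metric.ball (b i) δ := by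
        have h1 := hc.continuousAt.comp (hs.continuousOn.continuousAt (φ.open_baseSet.mem_nhds hx))
        refine h1.eventually (Metric.isOpen_ball.mem_nhds ?_)
        simp only [Function.comp, v]
        rw [φ.symm_apply_apply_mk hx, hw]
        exact Metric.mem_ball_self hδ
      exact ⟨_, inter_mem (φ.open_baseSet.mem_nhds hx) hev, fun y => φ.symm y v,
        hs.mono Set.inter_subset_left, fun y hy => hy.2⟩
  choose s hs using this
  refine ⟨fun i => s i, fun i => (s i).contMDiff, fun x => ?_⟩
  refine LinearIndependent.of_comp (R x) (hball ?_)
  exact (dist_pi_lt_iff hδ).2 fun i => hs i x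

/-- A smooth global frame identifies the bundle with a trivial one, smoothly in both directions. -/
theorem exists_contMDiff_linearEquiv [ContMDiffVectorBundle ∞ F E 𝓘(ℝ, B)]
    {ι : Type*} [Finite ι] (b : Module.Basis ι ℝ F) {s : ι → ∀ x, E x}
    (hs : ∀ i, ContMDiff 𝓘(ℝ, B) (𝓘(ℝ, B).prod 𝓘(ℝ, F)) ∞ (fun x => TotalSpace.mk' F x (s i x)))
    (hli : ∀ x, LinearIndependent ℝ (fun i => s i x)) :
    ∃ Ψ : ∀ x, F ≃ₗ[ℝ] E x,
      ContMDiff (𝓘(ℝ, B).prod 𝓘(ℝ, F)) (𝓘(ℝ, B).prod 𝓘(ℝ, F)) ∞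
        (fun p : M × F => TotalSpace.mk' F p.1 (Ψ p.1 p.2)) ∧
      ContMDiff (𝓘(ℝ, B).prod 𝓘(ℝ, F)) 𝓘(ℝ, F) ∞
        (fun e : TotalSpace F E => (Ψ e.proj).symm e.2) := by
  have := Fintype.ofFinite ι
  have hcard (x : M) : Fintype.card ι = Module.finrank ℝ (E x) := by
    rw [← ((trivializationAt F E x).linearEquivAt ℝ x
      (mem_baseSet_trivializationAt F E x)).symm.finrank_eq, Module.finrank_eq_card_basis b]
  have hspan (x : M) : ⊤ ≤ Submodule.span ℝ (Set.range fun i => s i x) := by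
    let e := (trivializationAt F E x).linearEquivAt ℝ x (mem_baseSet_trivializationAt F E x)
    have : FiniteDimensional ℝ (E x) := e.symm.finiteDimensional
    exact ((hli x).span_eq_top_of_card_eq_finrank' (hcard x)).ge
  let Ψ (x : M) : F ≃ₗ[ℝ] E x := b.equiv (Module.Basis.mk (hli x) (hspan x)) (Equiv.refl ι)
  have hΨ (x : M) (v : F) : Ψ x v = ∑ i, b.repr v i • s i x := by
    conv_lhs => rw [← b.sum_repr v]
    simp only [map_sum, map_smul, Ψ, Module.Basis.equiv_apply, Module.Basis.mk_apply,
      Equiv.refl_apply]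
  -- `A φ x` is `Ψ x` read in `φ`; smoothness of the inverse of `Ψ` reduces to that of operator
  -- inversion at invertible maps.
  let A (φ : Trivialization F (π F E)) (x : M) : F →L[ℝ] F :=
    ∑ i, (b.coord i).toContinuousLinearMap.smulRight (φ ⟨x, s i x⟩).2
  have hA (x₀ : M) : ContMDiffAt 𝓘(ℝ, B) 𝓘(ℝ, F →L[ℝ] F) ∞ (A (trivializationAt F E x₀)) x₀ := by
    refine ContMDiffAt.sum fun i _ => ?_
    have := (contMDiffAt_section x₀).1 (hs i x₀)
    exact ((ContinuousLinearMap.smulRightL ℝ F F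
      (b.coord i).toContinuousLinearMap).contDiff.contMDiff.contMDiffAt).comp x₀ this
  have hAΨ (φ : Trivialization F (π F E)) [MemTrivializationAtlas φ] {x : M} (hx : x ∈ φ.baseSet)
      (v : F) : A φ x v = (φ ⟨x, Ψ x v⟩).2 := by
    have hφ (w : E x) : (φ ⟨x, w⟩).2 = φ.linearMapAt ℝ x w :=
      (congrFun (φ.coe_linearMapAt_of_mem hx) w).symm
    simp only [A, hφ, hΨ, map_sum, map_smul, sum_apply]
    rfl
  refine ⟨Ψ, ?_, ?_⟩
  · intro p
    rw [contMDiffAt_totalSpace]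
    refine ⟨contMDiffAt_fst, ?_⟩
    let φ := trivializationAt F E p.1
    have hp : p.1 ∈ φ.baseSet := mem_baseSet_trivializationAt F E p.1
    have h1 := ((hA p.1).comp p contMDiffAt_fst).clm_apply contMDiffAt_snd
    refine h1.congr_of_eventuallyEq ?_
    filter_upwards [continuousAt_fst.eventually (φ.open_baseSet.mem_nhds hp)] with q hq
    exact (hAΨ φ hq q.2).symm
  · intro e
    let φ := trivializationAt F E e.proj
    have he : e.proj ∈ φ.baseSet := mem_baseSet_trivializationAt F E e.proj
    let C {x : M} (hx : x ∈ φ.baseSet) : F ≃L[ℝ] F :=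
      ((Ψ x).trans (φ.linearEquivAt ℝ x hx)).toContinuousLinearEquiv
    have hC {x : M} (hx : x ∈ φ.baseSet) : A φ x = C hx := by
      ext v
      rw [hAΨ φ hx]
      rfl
    have h0 : ContMDiffAt 𝓘(ℝ, F →L[ℝ] F) 𝓘(ℝ, F →L[ℝ] F) ∞ ContinuousLinearMap.inverse
        (A φ e.proj) := by
      rw [hC he]
      exact (contDiffAt_map_inverse (C he)).contMDiffAt
    have h1 := (h0.comp e.proj (hA e.proj)).comp e (contMDiffAt_proj E)
    have h2 := ((contMDiffAt_totalSpace (n := ∞) (IM := 𝓘(ℝ, B).prod 𝓘(ℝ, F))).1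
      (contMDiffAt_id (x := e))).2
    refine (h1.clm_apply h2).congr_of_eventuallyEq ?_
    filter_upwards [(FiberBundle.continuous_proj F E).continuousAt.eventually
      (φ.open_baseSet.mem_nhds he)] with e' he'
    simp only [Function.comp, id]
    rw [hC he', ContinuousLinearMap.inverse_equiv]
    refine ((C he').symm_apply_eq.2 ?_).symm
    change _ = (φ ⟨e'.proj, Ψ _ ((Ψ _).symm e'.2)⟩).2
    rw [LinearEquiv.apply_symm_apply]

end SmoothFrame

theorem mainTheorem5
    {B : Type*} [NormedAddCommGroup B] [NormedSpace ℝ B] [FiniteDimensional ℝ B]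
    {M : Type*} [TopologicalSpace M] [T2Space M] [SecondCountableTopology M]
    [ChartedSpace B M] [IsManifold 𝓘(ℝ, B) ∞ M] [ContractibleSpace M]
    {F : Type*} [NormedAddCommGroup F] [NormedSpace ℝ F] [FiniteDimensional ℝ F]
    (E : M → Type*) [∀ x, AddCommGroup (E x)] [∀ x, Module ℝ (E x)]
    [∀ x, TopologicalSpace (E x)] [TopologicalSpace (TotalSpace F E)]
    [FiberBundle F E] [VectorBundle ℝ F E] [ContMDiffVectorBundle ∞ F E 𝓘(ℝ, B)]
    (x₀ : M) :
    Nonempty (SmoothTrivialization (B := B) F E x₀) := by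
  have : LocallyCompactSpace M := Manifold.locallyCompact_of_finiteDimensional 𝓘(ℝ, B)
  obtain ⟨R, hR, hc⟩ := exists_continuous_fiberwise_injective (F := F) (E := E)
  let b := Module.finBasis ℝ F
  obtain ⟨s, hs, hli⟩ := exists_contMDiff_frame (B := B) hR hc b
  obtain ⟨Ψ, hΨ, hΨ'⟩ := exists_contMDiff_linearEquiv b hs hli
  let L := (trivializationAt F E x₀).continuousLinearEquivAt ℝ x₀
    (mem_baseSet_trivializationAt F E x₀)
  let _ := fiberChartedSpace F E x₀
  obtain ⟨hL, hL'⟩ : ContMDiff 𝓘(ℝ, F) 𝓘(ℝ, F) ∞ L ∧ ContMDiff 𝓘(ℝ, F) 𝓘(ℝ, F) ∞ L.symm :=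
    linearChartedSpace_contMDiff L L
  exact ⟨{
    toDiffeomorph :=
      { toFun := fun e => (e.proj, L.symm ((Ψ e.proj).symm e.2))
        invFun := fun p => ⟨p.1, Ψ p.1 (L p.2)⟩
        left_inv := fun e => by simp
        right_inv := fun p => by simp
        contMDiff_toFun := (contMDiff_proj E).prodMk (hL'.comp hΨ')
        contMDiff_invFun := hΨ.comp (contMDiff_fst.prodMk (hL.comp contMDiff_snd)) }
    fst_apply := fun _ => rfl
    isLinear := fun x => (L.symm.toLinearMap ∘ₗ (Ψ x).symm.toLinearMap).isLinear }⟩
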